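/- Let $T>0$, $d\ge 0$, let $\mathrm{Conv}(\mathbb R^d)$ be the family of nonempty compact convex subsets of $\mathbb R^d$ (Euclidean norm), $H$ the Hausdorff distance, and $\|A\|=H(A,\{0\})$. A function $F:[0,T]\to \mathrm{Conv}(\mathbb R^d)$ is Hukuhara differentiable if for every $t\in[0,T]$ there is $D_HF(t)\in\mathrm{Conv}(\mathbb R^d)$ such that for all small $h>0$ there are sets $C_h^{+},C_h^{-}\in\mathrm{Conv}(\mathbb R^d)$ with $F(t+h)=F(t)+C_h^{+}$ and $F(t)=F(t-h)+C_h^{-}$ (Minkowski sums), and $h^{-1}C_h^{\pm}\to D_HF(t)$ in $H$ as $h\to0+$ (only $C_h^{+}$ is considered at $t=0$, only $C_h^{-}$ at $t=T$). For $1<p<\infty$ let $\mathcal{IS}(F)$ be the set of functions $f:[0,T]\to\mathbb R^d$ with finite Riesz $p$-variation $$\sup_{0=t_0<\dots<t_n=T}\ \sum_{i=1}^n\frac{\|f(t_i)-f(t_{i-1})\|^p}{(t_i-t_{i-1})^{p-1}}<\infty ,$$ with $f(t)\in F(t)$ for all $t\in[0,T]$, and whose (a.e. existing) derivative satisfies $f'\in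 L^p$ and $f'(t)\in D_HF(t)$ for a.e. $t\in[0,T]$. For $g:[0,T]\to\mathbb R$ and $t\in[0,T]$ put $$(\mathcal{IS})\int_0^tF\,dg=\mathrm{cl}\Big\{\int_0^tf\,dg:\ f\in\mathcal{IS}(F)\Big\},$$ where $\int_0^tf\,dg$ is the Young integral, i.e. the limit of the sums $\sum_i f(t_{i-1})(g(t_i)-g(t_{i-1}))$ over partitions of $[0,t]$ as the mesh tends to $0$. Let $\alpha,\beta\in(0,1]$, let $g:[0,T]\to\mathbb R$ be $\alpha$-Hölder, $M_\alpha(g)=\sup_{0\le s<t\le T}|g(t)-g(s)|/(t-s)^\alpha$, and let $\rho\in(1-\alpha,\beta)$. Then there is a constant $C(\rho)>0$ (which may depend on $T,d,\alpha,\beta,g,\rho$ only) such that for every $p>1$ with $1/p+\alpha>1$ and all Hukuhara differentiable $F_1,F_2:[0,T]\to\mathrm{Conv}(\mathbb R^d)$ with bounded Hukuhara derivatives and $F_1(0)=F_2(0)$ the following holds. The function $s\mapsto H(D_HF_1(s),D_HF_2(s))$ is integrable on $[0,T]$; for every $t\in[0,T]$ the Young integrals $\int_0^tf\,dg$, $f\in\mathcal{IS}(F_1)\cup\mathcal{IS}(F_2)$,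 exist and the sets $(\mathcal{IS})\int_0^tF_i\,dg$, $i=1,2$, are nonempty and compact; and for every $t\in[0,T]$ and $\theta\in(0,1]$ $$H\Big((\mathcal{IS})\!\int_0^tF_1\,dg,\ (\mathcal{IS})\!\int_0^tF_2\,dg\Big)\le C(\rho)\Big(\int_0^TH(D_HF_1(s),D_HF_2(s))\,ds+(T+T^{1-\beta})\big(\sup_{[0,T]}\|D_HF_1\|+\sup_{[0,T]}\|D_HF_2\|\big)\theta^{\beta}\Big)\theta^{-\rho}$$ $$\qquad{}+M_\alpha(g)\,T^{\alpha}\int_0^TH(D_HF_1(s),D_HF_2(s))\,ds .$$ -/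

import Mathlib

open Set Filter Topology MeasureTheory
open scoped ENNReal

namespace SetYoung

noncomputable section

/-- `u 0 < u 1 < ... < u n` is a partition of `[a, b]` (for `a = b` only `n = 0` is possible). -/
structure IsPartition (a b : ℝ) (n : ℕ) (u : ℕ → ℝ) : Prop where
  left : u 0 = a
  right : u n = b
  lt : ∀ i < n, u i < u (i + 1)

/-- The quotients `|g t - g s| / (t - s) ^ α`, `0 ≤ s < t ≤ T`. -/
def holderQuotients (α T : ℝ) (g : ℝ → ℝ) : Set ℝ :=
  {r | ∃ s t : ℝ, 0 ≤ s ∧ s < t ∧ t ≤ T ∧ r = |g t - g s| / (t - s) ^ α}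

/-- `g` is `α`-Hölder on `[0, T]`. -/
def IsHolder (α T : ℝ) (g : ℝ → ℝ) : Prop :=
  BddAbove (holderQuotients α T g)

/-- The Hölder constant `M_α(g)` on `[0, T]`. -/
def holderConst (α T : ℝ) (g : ℝ → ℝ) : ℝ :=
  sSup (holderQuotients α T g)

section

variable {E : Type*} [NormedAddCommGroup E] [NormedSpace ℝ E]

/-- The Riesz `p`-variation of `f` on `[0, T]`. -/
def rieszVariation (p T : ℝ) (f : ℝ → E) : ℝ≥0∞ :=
  ⨆ (n : ℕ) (u : ℕ → ℝ) (_ : IsPartition 0 T n u),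
    ∑ i ∈ Finset.range n,
      ENNReal.ofReal (dist (f (u i)) (f (u (i + 1))) ^ p / (u (i + 1) - u i) ^ (p - 1))

/-- `f` has bounded Riesz `p`-variation on `[0, T]`. -/
def MemBV (p T : ℝ) (f : ℝ → E) : Prop :=
  rieszVariation p T f < ⊤

/-- The Hukuhara difference `A ÷ B` exists and is `C`. -/
def IsHukuharaDiff (A B C : ConvexBody E) : Prop :=
  A = B + C

/-- `D` is the Hukuhara derivative at `t ∈ [0, T]` of `F : [0, T] → Conv E`: both difference
quotients exist for small increments and tend to `D` in the Hausdorff metric. At `t = 0` only the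
right and at `t = T` only the left quotient is considered. -/
def HasHukuharaDerivAt (T : ℝ) (F : ℝ → ConvexBody E) (D : ConvexBody E) (t : ℝ) : Prop :=
  (t < T → ∃ C : ℝ → ConvexBody E,
    (∀ᶠ h in 𝓝[>] (0 : ℝ), IsHukuharaDiff (F (t + h)) (F t) (C h)) ∧
      Tendsto (fun h : ℝ => h⁻¹ • C h) (𝓝[>] 0) (𝓝 D)) ∧
  (0 < t → ∃ C : ℝ → ConvexBody E,
    (∀ᶠ h in 𝓝[>] (0 : ℝ), IsHukuharaDiff (F t) (F (t - h)) (C h)) ∧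
      Tendsto (fun h : ℝ => h⁻¹ • C h) (𝓝[>] 0) (𝓝 D))

/-- `F` is Hukuhara differentiable at every point of `[0, T]`. -/
def HukuharaDifferentiable (T : ℝ) (F : ℝ → ConvexBody E) : Prop :=
  ∀ t ∈ Icc 0 T, ∃ D, HasHukuharaDerivAt T F D t

open Classical in
/-- The Hukuhara derivative `D_H F` (with the value `{0}` where it does not exist). -/
def hukuharaDeriv (T : ℝ) (F : ℝ → ConvexBody E) (t : ℝ) : ConvexBody E :=
  if h : ∃ D, HasHukuharaDerivAt T F D t then h.choose else 0

/-- `‖A‖ = H(A, {0})`. -/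
def setNorm (A : ConvexBody E) : ℝ := dist A 0

/-- The numbers `‖D_H F(t)‖`, `t ∈ [0, T]`. -/
def derivNorms (T : ℝ) (F : ℝ → ConvexBody E) : Set ℝ :=
  (fun t => setNorm (hukuharaDeriv T F t)) '' Icc 0 T

/-- `IS(F)`: the selections `f` of `F` on `[0, T]` of bounded Riesz `p`-variation whose
(almost everywhere existing) derivative is an `L^p` selection of `D_H F`. -/
def IS (p T : ℝ) (F : ℝ → ConvexBody E) : Set (ℝ → E) :=
  {f | MemBV p T f ∧ (∀ t ∈ Icc 0 T, f t ∈ F t) ∧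
    MemLp (deriv f) (ENNReal.ofReal p) (volume.restrict (Icc 0 T)) ∧
    ∀ᵐ t ∂(volume.restrict (Icc 0 T)),
      DifferentiableAt ℝ f t ∧ deriv f t ∈ hukuharaDeriv T F t}

/-- The left-point Riemann sum of `f` with respect to `g`. -/
def riemannSum (f : ℝ → E) (g : ℝ → ℝ) (n : ℕ) (u : ℕ → ℝ) : E :=
  ∑ i ∈ Finset.range n, (g (u (i + 1)) - g (u i)) • f (u i)

/-- The Young integral of `f` with respect to `g` over `[a, b]` exists and equals `x`: the Riemann
sums converge to `x` as the mesh of the partition tends to `0`. -/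
def HasYoungIntegral (f : ℝ → E) (g : ℝ → ℝ) (a b : ℝ) (x : E) : Prop :=
  ∀ ε > 0, ∃ δ > 0, ∀ (n : ℕ) (u : ℕ → ℝ), IsPartition a b n u →
    (∀ i < n, u (i + 1) - u i < δ) → ‖riemannSum f g n u - x‖ < ε

/-- The set-valued Young integral of `F` with respect to `g` over `[0, t]`, for `t ∈ [0, T]`. -/
def setYoungIntegral (p T : ℝ) (F : ℝ → ConvexBody E) (g : ℝ → ℝ) (t : ℝ) : Set E :=
  closure {x | ∃ f ∈ IS p T F, HasYoungIntegral f g 0 t x}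

end

end

end SetYoung

open SetYoung

/-!
By a theorem of Riesz every `f ∈ IS p T F` is the primitive of its `L^p` derivative, so
integration by parts gives `∫₀ᵗ f dg = (g t - g 0) f(0) + ∫₀ᵗ (g t - g s) f'(s) ds`. This
expression depends on `(f(0), f')` in a Lipschitz way for `|·| + L¹`, with the oscillation of `g`
as Lipschitz constant. Conversely, support functions show that every primitive of an `L^p`
selection of `D_H F` starting in `F 0` belongs to `IS p T F`. Projecting `f(0)` and `f'`
metrically onto `F₂ 0` and `D_H F₂` therefore turns a selection of `F₁` into one of `F₂` that is
as close to it as the Hausdorff distances allow. The resulting bound is the last term of the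
estimate; the term with `θ` is nonnegative.
-/

namespace SetYoung

noncomputable section

section ConvexBodies

open scoped Pointwise

variable {E : Type*} [NormedAddCommGroup E]

section NormedSpace

variable [NormedSpace ℝ E]

theorem exists_dist_eq_infDist (K : ConvexBody E) (x : E) :
    ∃ y ∈ K, dist x y = Metric.infDist x K :=
  (K.isCompact.exists_infDist_eq_dist K.nonempty x).imp fun _ h => ⟨h.1, h.2.symm⟩

/-- A nearest point projection onto a convex body; in an inner product space this is the metric
projection. -/
def proj (K : ConvexBody E) (x : E) : E := (exists_dist_eq_infDist K x).choose

theorem proj_mem (K : ConvexBody E) (x : E) : proj K x ∈ K :=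
  (exists_dist_eq_infDist K x).choose_spec.1

theorem dist_proj_eq_infDist (K : ConvexBody E) (x : E) :
    dist x (proj K x) = Metric.infDist x K :=
  (exists_dist_eq_infDist K x).choose_spec.2

theorem proj_eq_self {K : ConvexBody E} {x : E} (hx : x ∈ K) : proj K x = x := by
  refine (dist_eq_zero.1 ?_).symm
  rw [dist_proj_eq_infDist, Metric.infDist_zero_of_mem hx]

theorem dist_proj_le_dist {A : ConvexBody E} (B : ConvexBody E) {x : E} (hx : x ∈ A) :
    dist x (proj B x) ≤ dist A B :=
  (dist_proj_eq_infDist B x).trans_le <|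
    Metric.infDist_le_hausdorffDist_of_mem (s := (A : Set E)) hx ConvexBody.hausdorffEDist_ne_top

theorem setNorm_nonneg (A : ConvexBody E) : 0 ≤ setNorm A := dist_nonneg

theorem norm_le_setNorm {A : ConvexBody E} {x : E} (hx : x ∈ A) : ‖x‖ ≤ setNorm A := by
  have h0 : proj (0 : ConvexBody E) x = 0 := proj_mem 0 x
  simpa [h0, setNorm] using dist_proj_le_dist 0 hx

instance [SecondCountableTopology E] : SecondCountableTopology (ConvexBody E) :=
  have h : Isometry fun K : ConvexBody E =>
      (⟨⟨K, K.isCompact⟩, K.nonempty⟩ : TopologicalSpace.NonemptyCompacts E) :=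
    Isometry.of_dist_eq fun _ _ => rfl
  h.isEmbedding.secondCountableTopology

end NormedSpace

variable [InnerProductSpace ℝ E]

theorem inner_sub_proj_le_zero {K : ConvexBody E} {y : E} (hy : y ∈ K) (x : E) :
    inner ℝ (x - proj K x) (y - proj K x) ≤ 0 := by
  refine (norm_eq_iInf_iff_real_inner_le_zero K.convex (proj_mem K x)).1 ?_ y hy
  simp only [← dist_eq_norm, dist_proj_eq_infDist, Metric.infDist_eq_iInf]

theorem lipschitzWith_proj (K : ConvexBody E) : LipschitzWith 1 (proj K) := by
  refine LipschitzWith.of_dist_le_mul fun x y => ?_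
  have hx := inner_sub_proj_le_zero (proj_mem K y) x
  have hy := inner_sub_proj_le_zero (proj_mem K x) y
  have hxy := real_inner_le_norm (x - y) (proj K x - proj K y)
  have h : ‖proj K x - proj K y‖ ^ 2 = inner ℝ (x - y) (proj K x - proj K y) +
      inner ℝ (x - proj K x) (proj K y - proj K x) +
      inner ℝ (y - proj K y) (proj K x - proj K y) := by
    rw [← real_inner_self_eq_norm_sq, ← neg_sub (proj K x) (proj K y), inner_neg_right,
      ← sub_eq_add_neg, ← inner_sub_left, ← inner_add_left]
    congr 1
    abel
  rw [dist_eq_norm, dist_eq_norm, NNReal.coe_one, one_mul]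
  by_contra! hlt
  nlinarith [norm_nonneg (x - y)]

theorem inner_sub_proj_le {A B : ConvexBody E} {y : E} (hy : y ∈ B) (x : E) :
    inner ℝ (x - proj A x) (y - proj A x) ≤ ‖x - proj A x‖ * dist B A := by
  have h := inner_sub_proj_le_zero (proj_mem A y) x
  have hy' : ‖y - proj A y‖ ≤ dist B A := dist_eq_norm y (proj A y) ▸ dist_proj_le_dist A hy
  calc inner ℝ (x - proj A x) (y - proj A x)
      = inner ℝ (x - proj A x) (y - proj A y) + inner ℝ (x - proj A x) (proj A y - proj A x) := by
        rw [← inner_add_right, sub_add_sub_cancel]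
    _ ≤ ‖x - proj A x‖ * ‖y - proj A y‖ := by
        linarith [real_inner_le_norm (x - proj A x) (y - proj A y)]
    _ ≤ ‖x - proj A x‖ * dist B A := by gcongr

theorem norm_proj_sub_proj_sq_le (A B : ConvexBody E) (x : E) :
    ‖proj B x - proj A x‖ ^ 2 ≤ (‖x - proj A x‖ + ‖x - proj B x‖) * dist B A := by
  have hA := inner_sub_proj_le (A := A) (proj_mem B x) x
  have hB := inner_sub_proj_le (A := B) (proj_mem A x) x
  rw [dist_comm A B] at hB
  have h : ‖proj B x - proj A x‖ ^ 2 = inner ℝ (x - proj A x) (proj B x - proj A x) +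
      inner ℝ (x - proj B x) (proj A x - proj B x) := by
    rw [← neg_sub (proj B x) (proj A x), inner_neg_right, ← sub_eq_add_neg, ← inner_sub_left,
      sub_sub_sub_cancel_left, real_inner_self_eq_norm_sq]
  linarith

theorem continuous_proj_left (x : E) : Continuous fun K : ConvexBody E => proj K x := by
  refine continuous_iff_continuousAt.2 fun A => tendsto_iff_norm_sub_tendsto_zero.2 ?_
  have hlim : Tendsto (fun B : ConvexBody E => (‖x - proj A x‖ + (‖x‖ + dist B 0)) * dist B A)
      (𝓝 A) (𝓝 0) := Continuous.tendsto' (by fun_prop) _ _ (by simp)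
  have hle : ∀ B : ConvexBody E, ‖proj B x - proj A x‖ ^ 2 ≤
      (‖x - proj A x‖ + (‖x‖ + dist B 0)) * dist B A := fun B => by
    refine (norm_proj_sub_proj_sq_le A B x).trans ?_
    gcongr
    exact (norm_sub_le _ _).trans (by gcongr; exact norm_le_setNorm (proj_mem B x))
  simpa using (squeeze_zero (fun _ => sq_nonneg _) hle hlim).sqrt

theorem continuous_proj : Continuous fun q : ConvexBody E × E => proj q.1 q.2 :=
  continuous_prod_of_continuous_lipschitzWith' _ 1 lipschitzWith_proj continuous_proj_left

/-- The support function of a convex body; it turns Minkowski sums into sums and the Hausdorff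
distance into the uniform distance on the unit sphere. -/
def supportFn (K : ConvexBody E) (u : E) : ℝ := sSup ((fun x => inner ℝ x u) '' (K : Set E))

theorem isCompact_image_inner (K : ConvexBody E) (u : E) :
    IsCompact ((fun x => inner ℝ x u) '' (K : Set E)) :=
  K.isCompact.image (by fun_prop)

theorem exists_inner_eq_supportFn (K : ConvexBody E) (u : E) :
    ∃ x ∈ K, inner ℝ x u = supportFn K u :=
  (isCompact_image_inner K u).sSup_mem (K.nonempty.image _)

theorem inner_le_supportFn {K : ConvexBody E} {x : E} (hx : x ∈ K) (u : E) :
    inner ℝ x u ≤ supportFn K u :=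
  le_csSup (isCompact_image_inner K u).bddAbove ⟨x, hx, rfl⟩

theorem supportFn_add (A B : ConvexBody E) (u : E) :
    supportFn (A + B) u = supportFn A u + supportFn B u := by
  apply le_antisymm
  · obtain ⟨x, hx, h⟩ := exists_inner_eq_supportFn (A + B) u
    obtain ⟨a, ha, b, hb, rfl⟩ := Set.mem_add.1 (show x ∈ (A : Set E) + B from hx)
    rw [← h, inner_add_left]
    exact add_le_add (inner_le_supportFn ha u) (inner_le_supportFn hb u)
  · obtain ⟨a, ha, h⟩ := exists_inner_eq_supportFn A u
    obtain ⟨b, hb, h'⟩ := exists_inner_eq_supportFn B u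
    rw [← h, ← h', ← inner_add_left]
    exact inner_le_supportFn (K := A + B) (Set.add_mem_add ha hb) u

theorem supportFn_smul {c : ℝ} (hc : 0 ≤ c) (A : ConvexBody E) (u : E) :
    supportFn (c • A) u = c * supportFn A u := by
  apply le_antisymm
  · obtain ⟨x, hx, h⟩ := exists_inner_eq_supportFn (c • A) u
    obtain ⟨a, ha, rfl⟩ := Set.mem_smul_set.1 (show x ∈ c • (A : Set E) from hx)
    rw [← h, real_inner_smul_left]
    exact mul_le_mul_of_nonneg_left (inner_le_supportFn ha u) hc
  · obtain ⟨a, ha, h⟩ := exists_inner_eq_supportFn A u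
    rw [← h, ← real_inner_smul_left]
    exact inner_le_supportFn (K := c • A) (Set.smul_mem_smul_set ha) u

theorem supportFn_le_add_dist (A B : ConvexBody E) (u : E) :
    supportFn A u ≤ supportFn B u + dist A B * ‖u‖ := by
  obtain ⟨x, hx, h⟩ := exists_inner_eq_supportFn A u
  have hxy : inner ℝ (x - proj B x) u ≤ dist A B * ‖u‖ :=
    (real_inner_le_norm _ _).trans (by rw [← dist_eq_norm]; gcongr; exact dist_proj_le_dist B hx)
  rw [inner_sub_left] at hxy
  linarith [inner_le_supportFn (proj_mem B x) u]

theorem abs_supportFn_sub_le (A B : ConvexBody E) (u : E) :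
    |supportFn A u - supportFn B u| ≤ dist A B * ‖u‖ :=
  abs_sub_le_iff.2 ⟨sub_le_iff_le_add'.2 (supportFn_le_add_dist A B u),
    sub_le_iff_le_add'.2 (dist_comm A B ▸ supportFn_le_add_dist B A u)⟩

theorem continuous_supportFn_left (u : E) : Continuous fun K : ConvexBody E => supportFn K u := by
  refine (LipschitzWith.of_dist_le_mul (K := ‖u‖₊) fun A B => ?_).continuous
  rw [Real.dist_eq, coe_nnnorm, mul_comm]
  exact abs_supportFn_sub_le A B u

theorem continuous_supportFn (K : ConvexBody E) : Continuous (supportFn K) := by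
  refine (LipschitzWith.of_le_add_mul (setNorm K).toNNReal fun u v => ?_).continuous
  rw [Real.coe_toNNReal _ (setNorm_nonneg K)]
  obtain ⟨x, hx, h⟩ := exists_inner_eq_supportFn K u
  have hxv : inner ℝ x (u - v) ≤ setNorm K * dist u v := by
    rw [dist_eq_norm]
    exact (real_inner_le_norm _ _).trans (by gcongr; exact norm_le_setNorm hx)
  rw [inner_sub_right] at hxv
  linarith [inner_le_supportFn hx v]

theorem supportFn_sub_proj (K : ConvexBody E) (x : E) :
    supportFn K (x - proj K x) = inner ℝ (proj K x) (x - proj K x) := by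
  apply le_antisymm _ (inner_le_supportFn (proj_mem K x) _)
  obtain ⟨y, hy, h⟩ := exists_inner_eq_supportFn K (x - proj K x)
  have hle := inner_sub_proj_le_zero hy x
  rw [real_inner_comm, inner_sub_left] at hle
  linarith

theorem dist_proj_le_of_forall_inner_le {K : ConvexBody E} {x : E} {r : ℝ} (hr : 0 ≤ r)
    (h : ∀ u, inner ℝ x u ≤ supportFn K u + r * ‖u‖) : dist x (proj K x) ≤ r := by
  have hu := h (x - proj K x)
  rw [supportFn_sub_proj, ← sub_le_iff_le_add', ← inner_sub_left, real_inner_self_eq_norm_sq] at hu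
  rw [dist_eq_norm]
  by_contra! hlt
  nlinarith

theorem mem_of_forall_inner_le {K : ConvexBody E} {x : E}
    (h : ∀ u, inner ℝ x u ≤ supportFn K u) : x ∈ K := by
  have hx : dist x (proj K x) ≤ 0 := dist_proj_le_of_forall_inner_le le_rfl (by simpa using h)
  rw [dist_le_zero.1 hx]
  exact proj_mem K x

theorem dist_le_of_forall_abs_supportFn_sub_le {A B : ConvexBody E} {r : ℝ} (hr : 0 ≤ r)
    (h : ∀ u, |supportFn A u - supportFn B u| ≤ r * ‖u‖) : dist A B ≤ r := by
  refine Metric.hausdorffDist_le_of_mem_dist hr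
    (fun x hx => ⟨proj B x, proj_mem B x, dist_proj_le_of_forall_inner_le hr fun u => ?_⟩)
    fun x hx => ⟨proj A x, proj_mem A x, dist_proj_le_of_forall_inner_le hr fun u => ?_⟩
  · linarith [(abs_le.1 (h u)).2, inner_le_supportFn (K := A) hx u]
  · linarith [(abs_le.1 (h u)).1, inner_le_supportFn (K := B) hx u]

theorem dist_le_iff_forall_abs_supportFn_sub_le {A B : ConvexBody E} {r : ℝ} (hr : 0 ≤ r)
    {ι : Type*} {v : ι → E} (hv : DenseRange v) :
    dist A B ≤ r ↔ ∀ i, |supportFn A (v i) - supportFn B (v i)| ≤ r * ‖v i‖ := by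
  refine ⟨fun h i => (abs_supportFn_sub_le A B _).trans (by gcongr), fun h => ?_⟩
  have hc : IsClosed {u | |supportFn A u - supportFn B u| ≤ r * ‖u‖} :=
    isClosed_le ((continuous_supportFn A).sub (continuous_supportFn B)).abs (by fun_prop)
  exact dist_le_of_forall_abs_supportFn_sub_le hr fun u => hv.induction_on u hc h

end ConvexBodies

section Measurability

variable {Ω : Type*} [MeasurableSpace Ω]

theorem stronglyMeasurable_of_measurable_dist {X : Type*} [PseudoMetricSpace X]
    [SecondCountableTopology X] {f : Ω → X} (h : ∀ c, Measurable fun s => dist (f s) c) :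
    StronglyMeasurable f := by
  borelize X
  have hbasis : TopologicalSpace.IsTopologicalBasis
      {U : Set X | ∃ c r, U = Metric.ball c r} := by
    refine TopologicalSpace.isTopologicalBasis_of_isOpen_of_nhds ?_ fun x U hx hU => ?_
    · rintro _ ⟨c, r, rfl⟩
      exact Metric.isOpen_ball
    · obtain ⟨r, hr, hrU⟩ := Metric.isOpen_iff.1 hU x hx
      exact ⟨_, ⟨x, r, rfl⟩, Metric.mem_ball_self hr, hrU⟩
  have hf : @Measurable _ _ _ (borel X) f := by
    rw [hbasis.borel_eq_generateFrom]
    refine measurable_generateFrom ?_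
    rintro _ ⟨c, r, rfl⟩
    exact measurableSet_lt (h c) measurable_const
  exact Measurable.stronglyMeasurable hf

theorem stronglyMeasurable_of_measurable_supportFn {E : Type*} [NormedAddCommGroup E]
    [InnerProductSpace ℝ E] [SecondCountableTopology E] {D : Ω → ConvexBody E}
    (h : ∀ u, Measurable fun s => supportFn (D s) u) : StronglyMeasurable D := by
  refine stronglyMeasurable_of_measurable_dist fun K => measurable_of_Iic fun r => ?_
  rcases lt_or_ge r 0 with hr | hr
  · have hempty : (fun s => dist (D s) K) ⁻¹' Iic r = ∅ :=
      eq_empty_of_forall_notMem fun s hs => (hr.trans_le dist_nonneg).not_ge hs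
    simp only [hempty, MeasurableSet.empty]
  · simp only [preimage, mem_Iic, dist_le_iff_forall_abs_supportFn_sub_le hr
      (TopologicalSpace.denseRange_denseSeq E), ofPred_forall]
    exact MeasurableSet.iInter fun n =>
      measurableSet_le ((h _).sub_const _).abs measurable_const

end Measurability

section Hukuhara

variable {E : Type*} [NormedAddCommGroup E]

theorem HukuharaDifferentiable.hasHukuharaDerivAt [NormedSpace ℝ E] {T t : ℝ}
    {F : ℝ → ConvexBody E} (hF : HukuharaDifferentiable T F) (ht : t ∈ Icc 0 T) :
    HasHukuharaDerivAt T F (hukuharaDeriv T F t) t := by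
  have h := hF t ht
  rw [hukuharaDeriv, dif_pos h]
  exact h.choose_spec

variable [InnerProductSpace ℝ E] {T t : ℝ} {F : ℝ → ConvexBody E}

theorem tendsto_supportFn_sub_div_of_isHukuharaDiff {A B C : ℝ → ConvexBody E} {D : ConvexBody E}
    (hC : ∀ᶠ h in 𝓝[>] (0 : ℝ), IsHukuharaDiff (A h) (B h) (C h))
    (hD : Tendsto (fun h : ℝ => h⁻¹ • C h) (𝓝[>] 0) (𝓝 D)) (u : E) :
    Tendsto (fun h => (supportFn (A h) u - supportFn (B h) u) / h) (𝓝[>] 0)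
      (𝓝 (supportFn D u)) := by
  refine (((continuous_supportFn_left u).tendsto D).comp hD).congr' ?_
  filter_upwards [hC, self_mem_nhdsWithin] with h hABC hh
  rw [IsHukuharaDiff] at hABC
  rw [Function.comp_apply, supportFn_smul (inv_nonneg.2 (mem_Ioi.1 hh).le), hABC, supportFn_add,
    add_sub_cancel_left, inv_mul_eq_div]

theorem HasHukuharaDerivAt.hasDerivWithinAt_supportFn_Ioi {D : ConvexBody E}
    (h : HasHukuharaDerivAt T F D t) (ht : t < T) (u : E) :
    HasDerivWithinAt (fun s => supportFn (F s) u) (supportFn D u) (Ioi t) t := by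
  obtain ⟨C, hC, hlim⟩ := h.1 ht
  have hsub : Tendsto (fun s => s - t) (𝓝[>] t) (𝓝[>] 0) := by
    have hc : ContinuousWithinAt (fun s => s - t) (Ioi t) t := by fun_prop
    simpa only [sub_self] using hc.tendsto_nhdsWithin (t := Ioi 0) fun s hs => sub_pos.2 hs
  rw [hasDerivWithinAt_iff_tendsto_slope' self_notMem_Ioi]
  refine ((tendsto_supportFn_sub_div_of_isHukuharaDiff hC hlim u).comp hsub).congr fun s => ?_
  simp only [Function.comp_apply, add_sub_cancel, slope_def_field]

theorem HasHukuharaDerivAt.hasDerivWithinAt_supportFn_Iio {D : ConvexBody E}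
    (h : HasHukuharaDerivAt T F D t) (ht : 0 < t) (u : E) :
    HasDerivWithinAt (fun s => supportFn (F s) u) (supportFn D u) (Iio t) t := by
  obtain ⟨C, hC, hlim⟩ := h.2 ht
  have hsub : Tendsto (fun s => t - s) (𝓝[<] t) (𝓝[>] 0) := by
    have hc : ContinuousWithinAt (fun s => t - s) (Iio t) t := by fun_prop
    simpa only [sub_self] using hc.tendsto_nhdsWithin (t := Ioi 0) fun s hs => sub_pos.2 hs
  rw [hasDerivWithinAt_iff_tendsto_slope' self_notMem_Iio]
  refine ((tendsto_supportFn_sub_div_of_isHukuharaDiff hC hlim u).comp hsub).congr fun s => ?_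
  simp only [Function.comp_apply, sub_sub_cancel, slope_comm _ t s, slope_def_field]

namespace HukuharaDifferentiable

theorem hasDerivAt_supportFn (hF : HukuharaDifferentiable T F) (ht : t ∈ Ioo 0 T) (u : E) :
    HasDerivAt (fun s => supportFn (F s) u) (supportFn (hukuharaDeriv T F t) u) t := by
  have h := hF.hasHukuharaDerivAt (Ioo_subset_Icc_self ht)
  have hd := (h.hasDerivWithinAt_supportFn_Iio ht.1 u).Iic_of_Iio.union
    (h.hasDerivWithinAt_supportFn_Ioi ht.2 u).Ici_of_Ioi
  rwa [Iic_union_Ici, hasDerivWithinAt_univ] at hd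

theorem continuousOn_supportFn (hF : HukuharaDifferentiable T F) (u : E) :
    ContinuousOn (fun s => supportFn (F s) u) (Icc 0 T) := by
  intro t ht
  have h := hF.hasHukuharaDerivAt ht
  have hleft : ContinuousWithinAt (fun s => supportFn (F s) u) (Icc 0 t) t := by
    rcases ht.1.eq_or_lt with rfl | h0
    · simp
    · exact (h.hasDerivWithinAt_supportFn_Iio h0 u).Iic_of_Iio.continuousWithinAt.mono
        Icc_subset_Iic_self
  have hright : ContinuousWithinAt (fun s => supportFn (F s) u) (Icc t T) t := by
    rcases ht.2.eq_or_lt with rfl | hT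
    · simp
    · exact (h.hasDerivWithinAt_supportFn_Ioi hT u).Ici_of_Ioi.continuousWithinAt.mono
        Icc_subset_Ici_self
  have hboth := hleft.union hright
  rwa [Icc_union_Icc_eq_Icc ht.1 ht.2] at hboth

theorem aestronglyMeasurable_hukuharaDeriv [SecondCountableTopology E]
    (hF : HukuharaDifferentiable T F) :
    AEStronglyMeasurable (hukuharaDeriv T F) (volume.restrict (Icc 0 T)) := by
  rw [← restrict_Ioo_eq_restrict_Icc, ← aestronglyMeasurable_indicator_iff measurableSet_Ioo]
  refine (stronglyMeasurable_of_measurable_supportFn fun u => ?_).aestronglyMeasurable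
  have hpiecewise : (fun s => supportFn ((Ioo 0 T).indicator (hukuharaDeriv T F) s) u) =
      (Ioo 0 T).piecewise (deriv fun s => supportFn (F s) u) fun _ => supportFn 0 u := by
    ext s
    by_cases hs : s ∈ Ioo 0 T
    · simp only [indicator_of_mem hs, piecewise_eq_of_mem _ _ _ hs,
        (hF.hasDerivAt_supportFn hs u).deriv]
    · simp only [indicator_of_notMem hs, piecewise_eq_of_notMem _ _ _ hs]
  rw [hpiecewise]
  exact (measurable_deriv _).piecewise measurableSet_Ioo measurable_const

theorem inner_integral_le [CompleteSpace E] (hF : HukuharaDifferentiable T F) {φ : ℝ → E}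
    (hφ : IntegrableOn φ (Icc 0 T)) (hmem : ∀ s ∈ Icc 0 T, φ s ∈ hukuharaDeriv T F s)
    (ht : t ∈ Icc 0 T) (u : E) :
    inner ℝ (∫ s in (0 : ℝ)..t, φ s) u ≤ supportFn (F t) u - supportFn (F 0) u := by
  have hsub : Icc 0 t ⊆ Icc 0 T := Icc_subset_Icc_right ht.2
  have hφt : IntegrableOn φ (Icc 0 t) := hφ.mono_set hsub
  rw [real_inner_comm, intervalIntegral.integral_of_le ht.1,
    ← integral_inner (hφt.mono_set Ioc_subset_Icc_self) u, ← intervalIntegral.integral_of_le ht.1]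
  refine intervalIntegral.integral_le_sub_of_hasDeriv_right_of_le ht.1
    ((hF.continuousOn_supportFn u).mono hsub)
    (fun s hs => (hF.hasHukuharaDerivAt
      (hsub (Ioo_subset_Icc_self hs))).hasDerivWithinAt_supportFn_Ioi (hs.2.trans_le ht.2) u)
    (hφt.const_inner u) fun s hs => ?_
  rw [real_inner_comm]
  exact inner_le_supportFn (hmem s (hsub (Ioo_subset_Icc_self hs))) u

theorem add_integral_mem [CompleteSpace E] (hF : HukuharaDifferentiable T F) {φ : ℝ → E} {a : E}
    (ha : a ∈ F 0) (hφ : IntegrableOn φ (Icc 0 T))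
    (hmem : ∀ᵐ s ∂volume.restrict (Icc 0 T), φ s ∈ hukuharaDeriv T F s) (ht : t ∈ Icc 0 T) :
    a + ∫ s in (0 : ℝ)..t, φ s ∈ F t := by
  -- Projecting changes `φ` only on a null set, and makes it a selection at every point.
  have hae : (fun s => proj (hukuharaDeriv T F s) (φ s)) =ᵐ[volume.restrict (Icc 0 T)] φ := by
    filter_upwards [hmem] with s hs using proj_eq_self hs
  have hint : ∫ s in (0 : ℝ)..t, proj (hukuharaDeriv T F s) (φ s) = ∫ s in (0 : ℝ)..t, φ s := by
    refine intervalIntegral.integral_congr_ae_restrict ?_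
    exact ae_restrict_of_ae_restrict_of_subset (uIoc_of_le ht.1 ▸
      Ioc_subset_Icc_self.trans (Icc_subset_Icc_right ht.2)) hae
  refine mem_of_forall_inner_le fun u => ?_
  rw [← hint, inner_add_left]
  linarith [inner_le_supportFn ha u, hF.inner_integral_le (Integrable.congr hφ hae.symm)
    (fun _ _ => proj_mem _ _) ht u]

end HukuharaDifferentiable

end Hukuhara

section RieszVariation

namespace IsPartition

variable {a b : ℝ} {n : ℕ} {u : ℕ → ℝ}

theorem mono (h : IsPartition a b n u) {i j : ℕ} (hij : i ≤ j) (hj : j ≤ n) : u i ≤ u j := by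
  induction j, hij using Nat.le_induction with
  | base => exact le_rfl
  | succ k _ ih => exact (ih (by omega)).trans (h.lt k (by omega)).le

theorem mem_Icc (h : IsPartition a b n u) {i : ℕ} (hi : i ≤ n) : u i ∈ Icc a b :=
  ⟨h.left ▸ h.mono (Nat.zero_le i) hi, h.right ▸ h.mono hi le_rfl⟩

theorem exists_append (h : IsPartition a b n u) {c : ℝ} (hbc : b < c) (w : ℝ → ℝ → ℝ) :
    ∃ v, IsPartition a c (n + 1) v ∧
      ∑ i ∈ Finset.range (n + 1), w (v i) (v (i + 1)) =
        ∑ i ∈ Finset.range n, w (u i) (u (i + 1)) + w b c := by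
  refine ⟨fun i => if i ≤ n then u i else c, ⟨?_, ?_, fun i hi => ?_⟩, ?_⟩
  · simpa using h.left
  · simp
  · rcases (Nat.lt_succ_iff.1 hi).eq_or_lt with rfl | hi'
    · simpa [h.right] using hbc
    · simpa [hi'.le, Nat.succ_le_of_lt hi'] using h.lt i hi'
  · rw [Finset.sum_range_succ]
    congr 1
    · refine Finset.sum_congr rfl fun i hi => ?_
      rw [Finset.mem_range] at hi
      simp [hi.le, Nat.succ_le_of_lt hi]
    · simp [h.right]

end IsPartition

/-- A finite family of nondegenerate subintervals `[l i, r i]`, `i ∈ S`, of `[a, b]` with pairwise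
disjoint interiors. Disjointness is stated for `Ioc`, as in `AbsolutelyContinuousOnInterval`. -/
structure IsNonoverlapping {ι : Type*} (a b : ℝ) (S : Finset ι) (l r : ι → ℝ) : Prop where
  le_left : ∀ i ∈ S, a ≤ l i
  lt : ∀ i ∈ S, l i < r i
  right_le : ∀ i ∈ S, r i ≤ b
  disjoint : (S : Set ι).PairwiseDisjoint fun i => Ioc (l i) (r i)

theorem IsNonoverlapping.of_insert {ι : Type*} [DecidableEq ι] {a b : ℝ} {S : Finset ι} {i : ι}
    {l r : ι → ℝ} (h : IsNonoverlapping a b (insert i S) l r) (hi : i ∉ S)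
    (hmax : ∀ j ∈ S, r j ≤ r i) : IsNonoverlapping a (l i) S l r where
  le_left j hj := h.le_left j (Finset.mem_insert_of_mem hj)
  lt j hj := h.lt j (Finset.mem_insert_of_mem hj)
  right_le j hj := by
    by_contra! hlt
    have hji : j ≠ i := fun hji => hi (hji ▸ hj)
    exact Set.disjoint_left.1 (h.disjoint (by simp [hj]) (by simp) hji)
      ⟨h.lt j (Finset.mem_insert_of_mem hj), le_rfl⟩ ⟨hlt, hmax j hj⟩
  disjoint := h.disjoint.subset (by simp)

theorem IsNonoverlapping.exists_isPartition_sum_le {ι : Type*} {a b : ℝ} {S : Finset ι}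
    {l r : ι → ℝ} (h : IsNonoverlapping a b S l r) (hab : a ≤ b) {w : ℝ → ℝ → ℝ}
    (hw : ∀ s t, s < t → 0 ≤ w s t) :
    ∃ n u, IsPartition a b n u ∧
      ∑ i ∈ S, w (l i) (r i) ≤ ∑ i ∈ Finset.range n, w (u i) (u (i + 1)) := by
  classical
  induction S using Finset.induction_on_max_value r generalizing b with
  | empty =>
    have htriv : IsPartition a a 0 fun _ => a := ⟨rfl, rfl, by simp⟩
    rcases hab.eq_or_lt with rfl | hab
    · exact ⟨0, _, htriv, by simp⟩
    · obtain ⟨v, hv, hsum⟩ := htriv.exists_append hab w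
      exact ⟨_, v, hv, by rw [hsum]; simpa using hw _ _ hab⟩
  | insert i S hi hmax ih =>
    have hiS : i ∈ insert i S := Finset.mem_insert_self i S
    obtain ⟨n, u, hu, hsum⟩ := ih (h.of_insert hi hmax) (h.le_left i hiS)
    obtain ⟨v, hv, hvsum⟩ := hu.exists_append (h.lt i hiS) w
    have hle : ∑ j ∈ insert i S, w (l j) (r j) ≤
        ∑ k ∈ Finset.range (n + 1), w (v k) (v (k + 1)) := by
      rw [Finset.sum_insert hi, hvsum]
      linarith
    rcases (h.right_le i hiS).eq_or_lt with hb | hb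
    · exact ⟨_, v, hb ▸ hv, hle⟩
    · obtain ⟨v', hv', hvsum'⟩ := hv.exists_append hb w
      exact ⟨_, v', hv', by linarith [hw _ _ hb]⟩

theorem absolutelyContinuousOnInterval_of_isNonoverlapping {X : Type*} [PseudoMetricSpace X]
    {f : ℝ → X} {a b : ℝ} (hab : a ≤ b)
    (h : ∀ ε > 0, ∃ δ > 0, ∀ (S : Finset ℕ) (l r : ℕ → ℝ), IsNonoverlapping a b S l r →
      ∑ i ∈ S, (r i - l i) < δ → ∑ i ∈ S, dist (f (l i)) (f (r i)) < ε) :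
    AbsolutelyContinuousOnInterval f a b := by
  rw [absolutelyContinuousOnInterval_iff]
  intro ε hε
  obtain ⟨δ, hδ, hsum⟩ := h ε hε
  refine ⟨δ, hδ, fun I ⟨hmem, hdisj⟩ hlen => ?_⟩
  rw [uIcc_of_le hab] at hmem
  set l : ℕ → ℝ := fun i => min (I.2 i).1 (I.2 i).2
  set r : ℕ → ℝ := fun i => max (I.2 i).1 (I.2 i).2
  set S := {i ∈ Finset.range I.1 | l i < r i}
  have hdist : ∀ i, dist (I.2 i).1 (I.2 i).2 = r i - l i := fun i => by
    rw [Real.dist_eq, max_sub_min_eq_abs']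
  have hdist_f : ∀ i, dist (f (I.2 i).1) (f (I.2 i).2) = dist (f (l i)) (f (r i)) := fun i => by
    rcases le_total (I.2 i).1 (I.2 i).2 with hle | hle
    · simp [l, r, hle]
    · simp [l, r, hle, dist_comm]
  have hI : ∀ i ∈ S, i ∈ Finset.range I.1 := fun i hi => (Finset.mem_filter.1 hi).1
  have hnon : IsNonoverlapping a b S l r :=
    { le_left := fun i hi => le_min (hmem i (hI i hi)).1.1 (hmem i (hI i hi)).2.1
      lt := fun i hi => (Finset.mem_filter.1 hi).2
      right_le := fun i hi => max_le (hmem i (hI i hi)).1.2 (hmem i (hI i hi)).2.2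
      disjoint := hdisj.subset hI }
  have hdegenerate : ∀ i ∈ Finset.range I.1, i ∉ S → r i = l i := fun i hi hiS =>
    le_antisymm (not_lt.1 fun hlt => hiS (Finset.mem_filter.2 ⟨hi, hlt⟩)) min_le_max
  simp only [hdist] at hlen
  simp only [hdist_f]
  rw [← Finset.sum_subset hI fun i hi hiS => by rw [hdegenerate i hi hiS, sub_self]] at hlen
  rw [← Finset.sum_subset hI fun i hi hiS => by rw [hdegenerate i hi hiS, dist_self]]
  exact hsum S l r hnon hlen

variable {E : Type*} [NormedAddCommGroup E] {p T : ℝ} {f : ℝ → E}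

theorem MemBV.sum_le {ι : Type*} (hf : MemBV p T f) (hT : 0 ≤ T) {S : Finset ι} {l r : ι → ℝ}
    (h : IsNonoverlapping 0 T S l r) :
    ∑ i ∈ S, dist (f (l i)) (f (r i)) ^ p / (r i - l i) ^ (p - 1) ≤
      (rieszVariation p T f).toReal := by
  have hw : ∀ s t, s < t → 0 ≤ dist (f s) (f t) ^ p / (t - s) ^ (p - 1) := fun s t hst => by
    have := sub_pos.2 hst
    positivity
  obtain ⟨n, u, hu, hsum⟩ := h.exists_isPartition_sum_le hT hw
  refine hsum.trans ((ENNReal.ofReal_le_iff_le_toReal hf.ne).1 ?_)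
  rw [ENNReal.ofReal_sum_of_nonneg fun i hi => hw _ _ (hu.lt i (Finset.mem_range.1 hi))]
  exact le_iSup_of_le n (le_iSup_of_le u (le_iSup_of_le hu le_rfl))

theorem le_mul_add_rpow_div {d ℓ K : ℝ} (hp : 1 < p) (hd : 0 ≤ d) (hℓ : 0 < ℓ) (hK : 0 < K) :
    d ≤ K * ℓ + d ^ p / ℓ ^ (p - 1) / K ^ (p - 1) := by
  rcases le_or_gt d (K * ℓ) with h | h
  · exact h.trans (le_add_of_nonneg_right (by positivity))
  · refine le_trans ?_ (le_add_of_nonneg_left (by positivity))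
    rw [div_div, ← Real.mul_rpow hℓ.le hK.le, le_div_iff₀ (by positivity)]
    calc d * (ℓ * K) ^ (p - 1) ≤ d * d ^ (p - 1) := by
          gcongr
          linarith
      _ = d ^ p := by rw [← Real.rpow_one_add' hd (by linarith), add_sub_cancel]

theorem MemBV.absolutelyContinuousOnInterval (hf : MemBV p T f) (hp : 1 < p) (hT : 0 ≤ T) :
    AbsolutelyContinuousOnInterval f 0 T := by
  refine absolutelyContinuousOnInterval_of_isNonoverlapping hT fun ε hε => ?_
  set V := (rieszVariation p T f).toReal
  obtain ⟨K, hKV, hK⟩ := (((tendsto_rpow_atTop (sub_pos.2 hp)).eventually_gt_atTop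
    (V / (ε / 2))).and (eventually_gt_atTop 0)).exists
  have hV : V / K ^ (p - 1) < ε / 2 := by
    rwa [div_lt_comm₀ (by positivity) (by positivity)]
  refine ⟨ε / (2 * K), by positivity, fun S l r h hlen => ?_⟩
  calc ∑ i ∈ S, dist (f (l i)) (f (r i))
      ≤ ∑ i ∈ S, (K * (r i - l i) +
          dist (f (l i)) (f (r i)) ^ p / (r i - l i) ^ (p - 1) / K ^ (p - 1)) :=
        Finset.sum_le_sum fun i hi =>
          le_mul_add_rpow_div hp dist_nonneg (sub_pos.2 (h.lt i hi)) hK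
    _ = K * ∑ i ∈ S, (r i - l i) +
          (∑ i ∈ S, dist (f (l i)) (f (r i)) ^ p / (r i - l i) ^ (p - 1)) / K ^ (p - 1) := by
        rw [Finset.sum_add_distrib, ← Finset.mul_sum, ← Finset.sum_div]
    _ ≤ K * (ε / (2 * K)) + V / K ^ (p - 1) := by
        gcongr
        exact hf.sum_le hT h
    _ < K * (ε / (2 * K)) + ε / 2 := by gcongr
    _ = ε := by field_simp; norm_num

theorem integrable_norm_rpow_of_memLp {Ω : Type*} [MeasurableSpace Ω] {μ : Measure Ω} {φ : Ω → E}
    (hp : 0 < p) (hφ : MemLp φ (ENNReal.ofReal p) μ) : Integrable (fun x => ‖φ x‖ ^ p) μ := by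
  simpa only [ENNReal.toReal_ofReal hp.le] using
    hφ.integrable_norm_rpow (ENNReal.ofReal_pos.2 hp).ne' ENNReal.ofReal_ne_top

theorem intervalIntegrable_of_integrableOn_Icc {φ : ℝ → E} {a b x y : ℝ}
    (hφ : IntegrableOn φ (Icc a b)) (hx : x ∈ Icc a b) (hy : y ∈ Icc a b) :
    IntervalIntegrable φ volume x y :=
  intervalIntegrable_iff.2 (hφ.mono_set (uIoc_subset_uIcc.trans (uIcc_subset_Icc hx hy)))

variable [NormedSpace ℝ E] {φ : ℝ → E}

theorem norm_integral_rpow_div_le {s t : ℝ} (hst : s < t) (hp : 1 < p)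
    (hφ : MemLp φ (ENNReal.ofReal p) (volume.restrict (Ioc s t))) :
    ‖∫ x in s..t, φ x‖ ^ p / (t - s) ^ (p - 1) ≤ ∫ x in s..t, ‖φ x‖ ^ p := by
  have hts : 0 < t - s := sub_pos.2 hst
  have hp0 : 0 < p := by linarith
  have hJensen := (convexOn_rpow hp.le).map_set_average_le (t := Ioc s t) (f := fun x => ‖φ x‖)
    (μ := volume) (Real.continuous_rpow_const hp0.le).continuousOn isClosed_Ici (by simp [hst])
    (by simp) (ae_of_all _ fun x => norm_nonneg (φ x))
    (hφ.integrable (by simpa using hp.le)).norm (integrable_norm_rpow_of_memLp hp0 hφ)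
  rw [← uIoc_of_le hst.le, interval_average_eq_div, interval_average_eq_div,
    Real.div_rpow (intervalIntegral.integral_nonneg hst.le fun _ _ => norm_nonneg _) hts.le,
    div_le_iff₀ (by positivity)] at hJensen
  rw [div_le_iff₀ (by positivity)]
  calc ‖∫ x in s..t, φ x‖ ^ p ≤ (∫ x in s..t, ‖φ x‖) ^ p := by
        gcongr
        exact intervalIntegral.norm_integral_le_integral_norm hst.le
    _ ≤ (∫ x in s..t, ‖φ x‖ ^ p) / (t - s) * (t - s) ^ p := hJensen
    _ = (∫ x in s..t, ‖φ x‖ ^ p) * (t - s) ^ (p - 1) := by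
        rw [Real.rpow_sub_one hts.ne']
        ring

theorem memBV_of_eq_add_integral {a : E} (hp : 1 < p)
    (hφ : MemLp φ (ENNReal.ofReal p) (volume.restrict (Icc 0 T)))
    (hf : ∀ x ∈ Icc 0 T, f x = a + ∫ s in (0 : ℝ)..x, φ s) : MemBV p T f := by
  have hint : IntegrableOn φ (Icc 0 T) := hφ.integrable (by simpa using hp.le)
  have hint_rpow : IntegrableOn (fun x => ‖φ x‖ ^ p) (Icc 0 T) :=
    integrable_norm_rpow_of_memLp (by linarith) hφ
  refine lt_of_le_of_lt (b := ENNReal.ofReal (∫ x in (0 : ℝ)..T, ‖φ x‖ ^ p)) ?_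
    ENNReal.ofReal_lt_top
  refine iSup_le fun n => iSup_le fun u => iSup_le fun hu => ?_
  have h0 : (0 : ℝ) ∈ Icc 0 T := hu.left ▸ hu.mem_Icc (Nat.zero_le n)
  have hterm : ∀ i < n, dist (f (u i)) (f (u (i + 1))) ^ p / (u (i + 1) - u i) ^ (p - 1) ≤
      ∫ x in u i..u (i + 1), ‖φ x‖ ^ p := fun i hi => by
    have hl := hu.mem_Icc hi.le
    have hr := hu.mem_Icc (Nat.succ_le_of_lt hi)
    rw [hf _ hl, hf _ hr, dist_add_left, dist_comm, dist_eq_norm,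
      intervalIntegral.integral_interval_sub_left
        (intervalIntegrable_of_integrableOn_Icc hint h0 hr)
        (intervalIntegrable_of_integrableOn_Icc hint h0 hl)]
    exact norm_integral_rpow_div_le (hu.lt i hi) hp <| hφ.mono_measure <|
      Measure.restrict_mono (Ioc_subset_Icc_self.trans (Icc_subset_Icc hl.1 hr.2)) le_rfl
  have hsum : ∑ i ∈ Finset.range n, ∫ x in u i..u (i + 1), ‖φ x‖ ^ p =
      ∫ x in (0 : ℝ)..T, ‖φ x‖ ^ p := by
    rw [intervalIntegral.sum_integral_adjacent_intervals fun i hi =>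
      intervalIntegrable_of_integrableOn_Icc hint_rpow (hu.mem_Icc hi.le)
        (hu.mem_Icc (Nat.succ_le_of_lt hi)), hu.left, hu.right]
  rw [← hsum, ← ENNReal.ofReal_sum_of_nonneg fun i hi => ?_]
  · exact ENNReal.ofReal_le_ofReal (Finset.sum_le_sum fun i hi => hterm i (Finset.mem_range.1 hi))
  · have := sub_pos.2 (hu.lt i (Finset.mem_range.1 hi))
    positivity

theorem MemBV.eq_add_integral_deriv [CompleteSpace E] (hf : MemBV p T f) (hp : 1 < p)
    (hLp : MemLp (deriv f) (ENNReal.ofReal p) (volume.restrict (Icc 0 T)))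
    (hdiff : ∀ᵐ t ∂volume.restrict (Icc 0 T), DifferentiableAt ℝ f t) {x : ℝ}
    (hx : x ∈ Icc 0 T) : f x = f 0 + ∫ s in (0 : ℝ)..x, deriv f s := by
  have hT : 0 ≤ T := hx.1.trans hx.2
  have h0 : (0 : ℝ) ∈ Icc 0 T := left_mem_Icc.2 hT
  have hint : IntervalIntegrable (deriv f) volume 0 T :=
    intervalIntegrable_of_integrableOn_Icc (hLp.integrable (by simpa using hp.le)) h0
      (right_mem_Icc.2 hT)
  have hprim : MemBV p T fun t => ∫ s in (0 : ℝ)..t, deriv f s :=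
    memBV_of_eq_add_integral hp hLp fun t _ => (zero_add _).symm
  have hac := (hf.absolutelyContinuousOnInterval hp hT).sub
    (hprim.absolutelyContinuousOnInterval hp hT)
  rw [ae_restrict_iff' measurableSet_Icc, ← uIcc_of_le hT] at hdiff
  obtain ⟨c, hc⟩ := hac.const_of_ae_hasDerivAt_zero (by
    filter_upwards [hdiff, hint.ae_hasDerivAt_integral] with t hft hprimt ht
    simpa using (hft ht).hasDerivAt.sub (hprimt ht 0 left_mem_uIcc))
  rw [uIcc_of_le hT] at hc
  have hconst := (hc x hx).trans (hc 0 h0).symm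
  simp only [Pi.sub_apply, intervalIntegral.integral_same, sub_zero] at hconst
  rw [← hconst, sub_add_cancel]

end RieszVariation

section YoungIntegral

variable {E : Type*} [NormedAddCommGroup E] [NormedSpace ℝ E] {T t : ℝ} {g : ℝ → ℝ}

section Uniqueness

variable {a b : ℝ}

theorem exists_isPartition_mesh_lt {δ : ℝ} (hab : a ≤ b) (hδ : 0 < δ) :
    ∃ n u, IsPartition a b n u ∧ ∀ i < n, u (i + 1) - u i < δ := by
  rcases hab.eq_or_lt with rfl | hab
  · exact ⟨0, fun _ => a, ⟨rfl, rfl, by simp⟩, by simp⟩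
  · obtain ⟨n, hn⟩ := exists_nat_gt ((b - a) / δ)
    have := sub_pos.2 hab
    have hn0 : (0 : ℝ) < n := lt_trans (by positivity) hn
    have hstep : ∀ i : ℕ, a + (i + 1 : ℕ) * ((b - a) / n) - (a + i * ((b - a) / n)) =
        (b - a) / n := fun i => by push_cast; ring
    refine ⟨n, fun i => a + i * ((b - a) / n), ⟨by simp, by field_simp; ring, fun i _ => ?_⟩,
      fun i _ => ?_⟩
    · rw [← sub_pos, hstep]
      positivity
    · rwa [hstep, div_lt_comm₀ hn0 hδ]

theorem HasYoungIntegral.unique {f : ℝ → E} {x y : E} (hab : a ≤ b)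
    (hx : HasYoungIntegral f g a b x) (hy : HasYoungIntegral f g a b y) : x = y := by
  refine eq_of_forall_dist_le fun ε hε => ?_
  obtain ⟨δ, hδ, h⟩ := hx (ε / 2) (half_pos hε)
  obtain ⟨δ', hδ', h'⟩ := hy (ε / 2) (half_pos hε)
  obtain ⟨n, u, hu, hmesh⟩ := exists_isPartition_mesh_lt hab (lt_min hδ hδ')
  have hsx := h n u hu fun i hi => (hmesh i hi).trans_le (min_le_left _ _)
  have hsy := h' n u hu fun i hi => (hmesh i hi).trans_le (min_le_right _ _)
  rw [← dist_eq_norm] at hsx hsy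
  linarith [dist_triangle_left x y (riemannSum f g n u)]

end Uniqueness

/-- The integral over `[0, t]` with respect to `g` of the primitive `x ↦ a + ∫ s in 0..x, φ s`,
in the form given by integration by parts, which makes sense for every continuous `g`. -/
def integralOfPrimitive (g : ℝ → ℝ) (a : E) (φ : ℝ → E) (t : ℝ) : E :=
  (g t - g 0) • a + ∫ s in (0 : ℝ)..t, (g t - g s) • φ s

variable {a b : E} {φ ψ : ℝ → E}

theorem intervalIntegrable_sub_smul (hg : ContinuousOn g (Icc 0 T)) (hφ : IntegrableOn φ (Icc 0 T))
    (c : ℝ) {x y : ℝ} (hx : x ∈ Icc 0 T) (hy : y ∈ Icc 0 T) :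
    IntervalIntegrable (fun s => (c - g s) • φ s) volume x y :=
  (intervalIntegrable_of_integrableOn_Icc hφ hx hy).continuousOn_smul
    ((continuousOn_const.sub hg).mono (uIcc_subset_Icc hx hy))

theorem integralOfPrimitive_sub_integralOfPrimitive (hg : ContinuousOn g (Icc 0 T))
    (hφ : IntegrableOn φ (Icc 0 T)) (a : E) {x y : ℝ} (hx : x ∈ Icc 0 T) (hy : y ∈ Icc 0 T) :
    integralOfPrimitive g a φ y - integralOfPrimitive g a φ x =
      (g y - g x) • (a + ∫ s in (0 : ℝ)..x, φ s) + ∫ s in x..y, (g y - g s) • φ s := by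
  have h0 : (0 : ℝ) ∈ Icc 0 T := ⟨le_rfl, hx.1.trans hx.2⟩
  have hsplit : ∫ s in (0 : ℝ)..x, (g y - g s) • φ s =
      (g y - g x) • (∫ s in (0 : ℝ)..x, φ s) + ∫ s in (0 : ℝ)..x, (g x - g s) • φ s := by
    rw [← intervalIntegral.integral_smul, ← intervalIntegral.integral_add
      (f := fun s => (g y - g x) • φ s)
      ((intervalIntegrable_of_integrableOn_Icc hφ h0 hx).smul (g y - g x))
      (intervalIntegrable_sub_smul hg hφ (g x) h0 hx)]
    simp only [← add_smul, sub_add_sub_cancel]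
  rw [integralOfPrimitive, integralOfPrimitive, ← intervalIntegral.integral_add_adjacent_intervals
    (intervalIntegrable_sub_smul hg hφ (g y) h0 hx) (intervalIntegrable_sub_smul hg hφ (g y) hx hy),
    hsplit]
  simp only [smul_add, sub_smul]
  abel

theorem norm_integral_sub_smul_le {x y η : ℝ} (hxy : x ≤ y) (hφ : IntervalIntegrable φ volume x y)
    (hη : ∀ s ∈ Ioc x y, |g y - g s| ≤ η) :
    ‖∫ s in x..y, (g y - g s) • φ s‖ ≤ η * ∫ s in x..y, ‖φ s‖ := by
  rw [← intervalIntegral.integral_const_mul]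
  refine intervalIntegral.norm_integral_le_of_norm_le hxy (ae_of_all _ fun s hs => ?_)
    (hφ.norm.const_mul η)
  rw [norm_smul, Real.norm_eq_abs]
  exact mul_le_mul_of_nonneg_right (hη s hs) (norm_nonneg _)

theorem norm_riemannSum_sub_integralOfPrimitive_le (hg : ContinuousOn g (Icc 0 T))
    (hφ : IntegrableOn φ (Icc 0 T)) {f : ℝ → E}
    (hf : ∀ x ∈ Icc 0 T, f x = a + ∫ s in (0 : ℝ)..x, φ s) (ht : t ∈ Icc 0 T) {n : ℕ} {u : ℕ → ℝ}
    (hu : IsPartition 0 t n u) {η : ℝ}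
    (hη : ∀ i < n, ∀ s ∈ Ioc (u i) (u (i + 1)), |g (u (i + 1)) - g s| ≤ η) :
    ‖riemannSum f g n u - integralOfPrimitive g a φ t‖ ≤ η * ∫ s in (0 : ℝ)..t, ‖φ s‖ := by
  have hmem : ∀ i ≤ n, u i ∈ Icc 0 T := fun i hi => Icc_subset_Icc_right ht.2 (hu.mem_Icc hi)
  have hφu : ∀ i < n, IntervalIntegrable φ volume (u i) (u (i + 1)) := fun i hi =>
    intervalIntegrable_of_integrableOn_Icc hφ (hmem i hi.le) (hmem (i + 1) hi)
  have htelescope : integralOfPrimitive g a φ t = ∑ i ∈ Finset.range n,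
      (integralOfPrimitive g a φ (u (i + 1)) - integralOfPrimitive g a φ (u i)) := by
    rw [Finset.sum_range_sub (fun i => integralOfPrimitive g a φ (u i)), hu.left, hu.right]
    simp [integralOfPrimitive]
  have hterm : ∀ i ∈ Finset.range n, ‖(g (u (i + 1)) - g (u i)) • f (u i) -
      (integralOfPrimitive g a φ (u (i + 1)) - integralOfPrimitive g a φ (u i))‖ ≤
        η * ∫ s in u i..u (i + 1), ‖φ s‖ := fun i hi => by
    rw [Finset.mem_range] at hi
    rw [integralOfPrimitive_sub_integralOfPrimitive hg hφ a (hmem i hi.le) (hmem (i + 1) hi),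
      hf _ (hmem i hi.le), sub_add_cancel_left, norm_neg]
    exact norm_integral_sub_smul_le (hu.lt i hi).le (hφu i hi) (hη i hi)
  rw [riemannSum, htelescope, ← Finset.sum_sub_distrib]
  refine (norm_sum_le_of_le _ hterm).trans_eq ?_
  rw [← Finset.mul_sum,
    intervalIntegral.sum_integral_adjacent_intervals fun i hi => (hφu i hi).norm, hu.left, hu.right]

theorem hasYoungIntegral_integralOfPrimitive (hg : ContinuousOn g (Icc 0 T))
    (hφ : IntegrableOn φ (Icc 0 T)) {f : ℝ → E}
    (hf : ∀ x ∈ Icc 0 T, f x = a + ∫ s in (0 : ℝ)..x, φ s) (ht : t ∈ Icc 0 T) :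
    HasYoungIntegral f g 0 t (integralOfPrimitive g a φ t) := by
  intro ε hε
  set I := ∫ s in (0 : ℝ)..t, ‖φ s‖
  have hI : 0 ≤ I := intervalIntegral.integral_nonneg ht.1 fun _ _ => norm_nonneg _
  have hη : 0 < ε / (I + 1) := by positivity
  obtain ⟨δ, hδ, hgδ⟩ := Metric.uniformContinuousOn_iff.1
    (isCompact_Icc.uniformContinuousOn_of_continuous hg) _ hη
  refine ⟨δ, hδ, fun n u hu hmesh => ?_⟩
  have hosc : ∀ i < n, ∀ s ∈ Ioc (u i) (u (i + 1)), |g (u (i + 1)) - g s| ≤ ε / (I + 1) := by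
    intro i hi s hs
    have hl := hu.mem_Icc hi.le
    have hr := hu.mem_Icc (Nat.succ_le_of_lt hi)
    refine (hgδ _ ⟨hr.1, hr.2.trans ht.2⟩ s ⟨hl.1.trans hs.1.le, hs.2.trans (hr.2.trans ht.2)⟩
      ?_).le
    rw [Real.dist_eq, abs_of_nonneg (sub_nonneg.2 hs.2)]
    linarith [hmesh i hi, hs.1]
  calc ‖riemannSum f g n u - integralOfPrimitive g a φ t‖ ≤ ε / (I + 1) * I :=
        norm_riemannSum_sub_integralOfPrimitive_le hg hφ hf ht hu hosc
    _ < ε / (I + 1) * (I + 1) := by gcongr; exact lt_add_one I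
    _ = ε := div_mul_cancel₀ ε (by positivity)

theorem integralOfPrimitive_sub (hg : ContinuousOn g (Icc 0 T)) (hφ : IntegrableOn φ (Icc 0 T))
    (hψ : IntegrableOn ψ (Icc 0 T)) (ht : t ∈ Icc 0 T) :
    integralOfPrimitive g (a - b) (φ - ψ) t =
      integralOfPrimitive g a φ t - integralOfPrimitive g b ψ t := by
  have h0 : (0 : ℝ) ∈ Icc 0 T := ⟨le_rfl, ht.1.trans ht.2⟩
  simp only [integralOfPrimitive, smul_sub, Pi.sub_apply]
  rw [intervalIntegral.integral_sub (intervalIntegrable_sub_smul hg hφ (g t) h0 ht)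
    (intervalIntegrable_sub_smul hg hψ (g t) h0 ht), add_sub_add_comm]

theorem norm_integralOfPrimitive_le {M : ℝ} {w : ℝ → ℝ}
    (hM : ∀ s ∈ Icc 0 T, ∀ t ∈ Icc 0 T, |g t - g s| ≤ M) (hw : IntegrableOn w (Icc 0 T))
    (hφw : ∀ᵐ s ∂volume.restrict (Icc 0 T), ‖φ s‖ ≤ w s) (ht : t ∈ Icc 0 T) :
    ‖integralOfPrimitive g a φ t‖ ≤ M * (‖a‖ + ∫ s in (0 : ℝ)..T, w s) := by
  have hT : 0 ≤ T := ht.1.trans ht.2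
  have h0 : (0 : ℝ) ∈ Icc 0 T := left_mem_Icc.2 hT
  have hM0 : 0 ≤ M := (abs_nonneg _).trans (hM 0 h0 t ht)
  have hw0t := intervalIntegrable_of_integrableOn_Icc hw h0 ht
  have hw0T := intervalIntegrable_of_integrableOn_Icc hw h0 (right_mem_Icc.2 hT)
  rw [ae_restrict_iff' measurableSet_Icc] at hφw
  have hinit : ‖(g t - g 0) • a‖ ≤ M * ‖a‖ := by
    rw [norm_smul, Real.norm_eq_abs]
    exact mul_le_mul_of_nonneg_right (hM 0 h0 t ht) (norm_nonneg a)
  have hint : ‖∫ s in (0 : ℝ)..t, (g t - g s) • φ s‖ ≤ ∫ s in (0 : ℝ)..t, M * w s := by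
    refine intervalIntegral.norm_integral_le_of_norm_le ht.1 ?_ (hw0t.const_mul M)
    filter_upwards [hφw] with s hs hst
    have hsT : s ∈ Icc 0 T := ⟨hst.1.le, hst.2.trans ht.2⟩
    rw [norm_smul, Real.norm_eq_abs]
    exact mul_le_mul (hM s hsT t ht) (hs hsT) (norm_nonneg _) hM0
  have hmono : ∫ s in (0 : ℝ)..t, w s ≤ ∫ s in (0 : ℝ)..T, w s := by
    refine intervalIntegral.integral_mono_interval le_rfl ht.1 ht.2 ?_ hw0T
    rw [EventuallyLE, ae_restrict_iff' measurableSet_Ioc]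
    filter_upwards [hφw] with s hs hsT using (norm_nonneg _).trans (hs (Ioc_subset_Icc_self hsT))
  rw [intervalIntegral.integral_const_mul] at hint
  calc ‖integralOfPrimitive g a φ t‖ ≤ M * ‖a‖ + M * ∫ s in (0 : ℝ)..t, w s :=
        (norm_add_le _ _).trans (add_le_add hinit hint)
    _ ≤ M * (‖a‖ + ∫ s in (0 : ℝ)..T, w s) := by
        rw [← mul_add]
        gcongr

end YoungIntegral

section Holder

variable {α T s t : ℝ} {g : ℝ → ℝ}

theorem holderConst_nonneg (α T : ℝ) (g : ℝ → ℝ) : 0 ≤ holderConst α T g := by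
  refine Real.sSup_nonneg ?_
  rintro _ ⟨s, t, _, hst, _, rfl⟩
  have : 0 < t - s := sub_pos.2 hst
  positivity

namespace IsHolder

theorem abs_sub_le (hg : IsHolder α T g) (hs : s ∈ Icc 0 T) (ht : t ∈ Icc 0 T) :
    |g t - g s| ≤ holderConst α T g * |t - s| ^ α := by
  wlog hst : s ≤ t generalizing s t
  · rw [abs_sub_comm (g t), abs_sub_comm t]
    exact this ht hs (le_of_not_ge hst)
  rcases hst.eq_or_lt with rfl | hst
  · simpa using mul_nonneg (holderConst_nonneg α T g) (Real.rpow_nonneg le_rfl α)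
  · have h : 0 < t - s := sub_pos.2 hst
    rw [abs_of_pos h, ← div_le_iff₀ (by positivity)]
    exact le_csSup hg ⟨s, t, hs.1, hst, ht.2, rfl⟩

theorem abs_sub_le_mul_rpow (hg : IsHolder α T g) (hα : 0 ≤ α) (hs : s ∈ Icc 0 T)
    (ht : t ∈ Icc 0 T) : |g t - g s| ≤ holderConst α T g * T ^ α := by
  refine (hg.abs_sub_le hs ht).trans ?_
  have := holderConst_nonneg α T g
  gcongr
  simpa using abs_sub_le_of_nonneg_of_le ht.1 ht.2 hs.1 hs.2

theorem continuousOn (hg : IsHolder α T g) (hα : 0 < α) : ContinuousOn g (Icc 0 T) := by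
  intro t ht
  have hlim : Tendsto (fun s => holderConst α T g * |s - t| ^ α) (𝓝[Icc 0 T] t) (𝓝 0) := by
    refine (Continuous.tendsto' ?_ _ _ ?_).mono_left nhdsWithin_le_nhds
    · exact continuous_const.mul
        ((continuous_abs.comp (continuous_sub_right t)).rpow_const fun _ => Or.inr hα.le)
    · simp [Real.zero_rpow hα.ne']
  refine tendsto_iff_dist_tendsto_zero.2
    (squeeze_zero' (Eventually.of_forall fun _ => dist_nonneg) ?_ hlim)
  filter_upwards [self_mem_nhdsWithin] with s hs using hg.abs_sub_le ht hs

end IsHolder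

end Holder

section Selections

variable {E : Type*} [NormedAddCommGroup E] {p T : ℝ} {φ : ℝ → E}

section NormedSpace

variable [NormedSpace ℝ E] {F : ℝ → ConvexBody E}

theorem ae_hasDerivAt_add_integral [CompleteSpace E] (hT : 0 ≤ T)
    (hφ : IntegrableOn φ (Icc 0 T)) (a : E) :
    ∀ᵐ s ∂volume.restrict (Icc 0 T),
      HasDerivAt (fun x => a + ∫ r in (0 : ℝ)..x, φ r) (φ s) s := by
  have hint : IntervalIntegrable φ volume 0 T :=
    intervalIntegrable_of_integrableOn_Icc hφ (left_mem_Icc.2 hT) (right_mem_Icc.2 hT)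
  rw [ae_restrict_iff' measurableSet_Icc, ← uIcc_of_le hT]
  filter_upwards [hint.ae_hasDerivAt_integral] with s hs hsT
  exact (hs hsT 0 left_mem_uIcc).const_add a

theorem memLp_of_ae_mem {Ω : Type*} [MeasurableSpace Ω] {μ : Measure Ω} {q : ℝ≥0∞}
    {D : Ω → ConvexBody E} {φ : Ω → E} (hD : MemLp (fun s => setNorm (D s)) q μ)
    (hφ : AEStronglyMeasurable φ μ) (hmem : ∀ᵐ s ∂μ, φ s ∈ D s) : MemLp φ q μ :=
  hD.mono' hφ (hmem.mono fun _ hs => norm_le_setNorm hs)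

theorem memLp_dist {Ω : Type*} [MeasurableSpace Ω] {μ : Measure Ω} {q : ℝ≥0∞}
    {D₁ D₂ : Ω → ConvexBody E} (hm₁ : AEStronglyMeasurable D₁ μ) (hm₂ : AEStronglyMeasurable D₂ μ)
    (hD₁ : MemLp (fun s => setNorm (D₁ s)) q μ) (hD₂ : MemLp (fun s => setNorm (D₂ s)) q μ) :
    MemLp (fun s => dist (D₁ s) (D₂ s)) q μ := by
  refine (hD₁.add hD₂).mono' (hm₁.dist hm₂) (ae_of_all _ fun s => ?_)
  rw [Real.norm_of_nonneg dist_nonneg]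
  exact dist_triangle_right _ _ 0

namespace IS

theorem eq_add_integral_deriv [CompleteSpace E] {f : ℝ → E} (hf : f ∈ IS p T F) (hp : 1 < p) {x : ℝ}
    (hx : x ∈ Icc 0 T) : f x = f 0 + ∫ s in (0 : ℝ)..x, deriv f s :=
  hf.1.eq_add_integral_deriv hp hf.2.2.1 (hf.2.2.2.mono fun _ hs => hs.1) hx

theorem integrableOn_deriv {f : ℝ → E} (hf : f ∈ IS p T F) (hp : 1 < p) :
    IntegrableOn (deriv f) (Icc 0 T) :=
  hf.2.2.1.integrable (by simpa using hp.le)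

theorem ae_deriv_mem {f : ℝ → E} (hf : f ∈ IS p T F) :
    ∀ᵐ s ∂volume.restrict (Icc 0 T), deriv f s ∈ hukuharaDeriv T F s :=
  hf.2.2.2.mono fun _ hs => hs.2

theorem hasYoungIntegral [CompleteSpace E] {f : ℝ → E} (hf : f ∈ IS p T F) (hp : 1 < p) {g : ℝ → ℝ}
    (hg : ContinuousOn g (Icc 0 T)) {t : ℝ} (ht : t ∈ Icc 0 T) :
    HasYoungIntegral f g 0 t (integralOfPrimitive g (f 0) (deriv f) t) :=
  hasYoungIntegral_integralOfPrimitive hg (integrableOn_deriv hf hp)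
    (fun _ hx => eq_add_integral_deriv hf hp hx) ht

end IS

end NormedSpace

variable [InnerProductSpace ℝ E]

theorem integrableOn_dist_hukuharaDeriv [SecondCountableTopology E] {F₁ F₂ : ℝ → ConvexBody E}
    (hp : 1 < p) (hF₁ : HukuharaDifferentiable T F₁) (hF₂ : HukuharaDifferentiable T F₂)
    (hD₁ : MemLp (fun s => setNorm (hukuharaDeriv T F₁ s)) (ENNReal.ofReal p)
      (volume.restrict (Icc 0 T)))
    (hD₂ : MemLp (fun s => setNorm (hukuharaDeriv T F₂ s)) (ENNReal.ofReal p)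
      (volume.restrict (Icc 0 T))) :
    IntegrableOn (fun s => dist (hukuharaDeriv T F₁ s) (hukuharaDeriv T F₂ s)) (Icc 0 T) :=
  (memLp_dist hF₁.aestronglyMeasurable_hukuharaDeriv hF₂.aestronglyMeasurable_hukuharaDeriv
    hD₁ hD₂).integrable (by simpa using hp.le)

namespace HukuharaDifferentiable

variable {F : ℝ → ConvexBody E} (hF : HukuharaDifferentiable T F)
include hF

theorem memLp_setNorm_hukuharaDeriv [SecondCountableTopology E] (hB : BddAbove (derivNorms T F))
    (q : ℝ≥0∞) :
    MemLp (fun s => setNorm (hukuharaDeriv T F s)) q (volume.restrict (Icc 0 T)) := by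
  refine MemLp.of_bound (hF.aestronglyMeasurable_hukuharaDeriv.dist aestronglyMeasurable_const)
    (sSup (derivNorms T F)) ?_
  filter_upwards [ae_restrict_mem measurableSet_Icc] with s hs
  rw [Real.norm_of_nonneg (setNorm_nonneg _)]
  exact le_csSup hB (mem_image_of_mem _ hs)

theorem add_integral_mem_IS [CompleteSpace E] (hT : 0 ≤ T) (hp : 1 < p) {a : E} (ha : a ∈ F 0)
    (hφ : MemLp φ (ENNReal.ofReal p) (volume.restrict (Icc 0 T)))
    (hmem : ∀ᵐ s ∂volume.restrict (Icc 0 T), φ s ∈ hukuharaDeriv T F s) :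
    (fun x => a + ∫ s in (0 : ℝ)..x, φ s) ∈ IS p T F := by
  have hint : IntegrableOn φ (Icc 0 T) := hφ.integrable (by simpa using hp.le)
  have hderiv := ae_hasDerivAt_add_integral hT hint a
  refine ⟨memBV_of_eq_add_integral hp hφ fun _ _ => rfl,
    fun t ht => hF.add_integral_mem ha hint hmem ht,
    hφ.ae_eq (hderiv.mono fun s hs => hs.deriv.symm), ?_⟩
  filter_upwards [hderiv, hmem] with s hs hsD
  exact ⟨hs.differentiableAt, hs.deriv.symm ▸ hsD⟩

theorem exists_mem_IS_deriv_ae_eq_proj [SecondCountableTopology E] [CompleteSpace E]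
    (hT : 0 ≤ T) (hp : 1 < p)
    (hD : MemLp (fun s => setNorm (hukuharaDeriv T F s)) (ENNReal.ofReal p)
      (volume.restrict (Icc 0 T)))
    (x : E) (hφ : AEStronglyMeasurable φ (volume.restrict (Icc 0 T))) :
    ∃ f ∈ IS p T F, f 0 = proj (F 0) x ∧
      ∀ᵐ s ∂volume.restrict (Icc 0 T), deriv f s = proj (hukuharaDeriv T F s) (φ s) := by
  have hmem : ∀ᵐ s ∂volume.restrict (Icc 0 T),
      proj (hukuharaDeriv T F s) (φ s) ∈ hukuharaDeriv T F s := ae_of_all _ fun s => proj_mem _ _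
  have hLp := memLp_of_ae_mem hD (continuous_proj.comp_aestronglyMeasurable
    (hF.aestronglyMeasurable_hukuharaDeriv.prodMk hφ)) hmem
  refine ⟨_, hF.add_integral_mem_IS hT hp (proj_mem (F 0) x) hLp hmem, by simp, ?_⟩
  filter_upwards [ae_hasDerivAt_add_integral hT (hLp.integrable (by simpa using hp.le)) _]
    with s hs using hs.deriv

end HukuharaDifferentiable

end Selections

section SetYoungIntegral

variable {E : Type*} [NormedAddCommGroup E] {p T t M : ℝ} {g : ℝ → ℝ}

section NormedSpace

variable [NormedSpace ℝ E] {F : ℝ → ConvexBody E}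

theorem sSup_derivNorms_nonneg (T : ℝ) (F : ℝ → ConvexBody E) : 0 ≤ sSup (derivNorms T F) :=
  Real.sSup_nonneg (forall_mem_image.2 fun _ _ => setNorm_nonneg _)

theorem integral_dist_hukuharaDeriv_nonneg (hT : 0 ≤ T) (F₁ F₂ : ℝ → ConvexBody E) :
    0 ≤ ∫ s in (0 : ℝ)..T, dist (hukuharaDeriv T F₁ s) (hukuharaDeriv T F₂ s) :=
  intervalIntegral.integral_nonneg hT fun _ _ => dist_nonneg

theorem mul_integral_dist_add_mul_rpow_nonneg {C θ : ℝ} (hC : 0 ≤ C) (hT : 0 ≤ T) (hθ : 0 ≤ θ)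
    (β ρ : ℝ) (F₁ F₂ : ℝ → ConvexBody E) :
    0 ≤ C * ((∫ s in (0 : ℝ)..T, dist (hukuharaDeriv T F₁ s) (hukuharaDeriv T F₂ s)) +
      (T + T ^ (1 - β)) * (sSup (derivNorms T F₁) + sSup (derivNorms T F₂)) * θ ^ β) *
        θ ^ (-ρ) := by
  have hI := integral_dist_hukuharaDeriv_nonneg hT F₁ F₂
  have hS₁ := sSup_derivNorms_nonneg T F₁
  have hS₂ := sSup_derivNorms_nonneg T F₂
  positivity

theorem isCompact_setYoungIntegral [ProperSpace E] (hp : 1 < p) (hg : ContinuousOn g (Icc 0 T))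
    (hM : ∀ s ∈ Icc 0 T, ∀ t ∈ Icc 0 T, |g t - g s| ≤ M)
    (hD : MemLp (fun s => setNorm (hukuharaDeriv T F s)) (ENNReal.ofReal p)
      (volume.restrict (Icc 0 T)))
    (ht : t ∈ Icc 0 T) : IsCompact (setYoungIntegral p T F g t) := by
  have h0 : (0 : ℝ) ∈ Icc 0 T := left_mem_Icc.2 (ht.1.trans ht.2)
  have hM0 : 0 ≤ M := (abs_nonneg _).trans (hM 0 h0 t ht)
  refine (isBounded_iff_forall_norm_le.2
    ⟨M * (setNorm (F 0) + ∫ s in (0 : ℝ)..T, setNorm (hukuharaDeriv T F s)), ?_⟩).isCompact_closure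
  rintro x ⟨f, hf, hx⟩
  rw [hx.unique ht.1 (IS.hasYoungIntegral hf hp hg ht)]
  refine (norm_integralOfPrimitive_le hM (hD.integrable (by simpa using hp.le))
    ((IS.ae_deriv_mem hf).mono fun s hs => norm_le_setNorm hs) ht).trans ?_
  gcongr
  exact norm_le_setNorm (hf.2.1 0 h0)

end NormedSpace

variable [InnerProductSpace ℝ E] {F F₁ F₂ : ℝ → ConvexBody E}

theorem setYoungIntegral_nonempty [SecondCountableTopology E] [CompleteSpace E] (hp : 1 < p)
    (hg : ContinuousOn g (Icc 0 T)) (hF : HukuharaDifferentiable T F)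
    (hD : MemLp (fun s => setNorm (hukuharaDeriv T F s)) (ENNReal.ofReal p)
      (volume.restrict (Icc 0 T)))
    (ht : t ∈ Icc 0 T) : (setYoungIntegral p T F g t).Nonempty := by
  obtain ⟨f, hf, -⟩ := hF.exists_mem_IS_deriv_ae_eq_proj (ht.1.trans ht.2) hp hD 0
    aestronglyMeasurable_zero
  exact ⟨_, subset_closure ⟨f, hf, IS.hasYoungIntegral hf hp hg ht⟩⟩

theorem exists_hasYoungIntegral_dist_le [SecondCountableTopology E] [CompleteSpace E] (hp : 1 < p)
    (hg : ContinuousOn g (Icc 0 T)) (hM : ∀ s ∈ Icc 0 T, ∀ t ∈ Icc 0 T, |g t - g s| ≤ M)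
    (hF₂ : HukuharaDifferentiable T F₂)
    (hD₂ : MemLp (fun s => setNorm (hukuharaDeriv T F₂ s)) (ENNReal.ofReal p)
      (volume.restrict (Icc 0 T)))
    (hdist : IntegrableOn (fun s => dist (hukuharaDeriv T F₁ s) (hukuharaDeriv T F₂ s)) (Icc 0 T))
    (ht : t ∈ Icc 0 T) {f₁ : ℝ → E} (hf₁ : f₁ ∈ IS p T F₁) {x : E}
    (hx : HasYoungIntegral f₁ g 0 t x) :
    ∃ y, (∃ f₂ ∈ IS p T F₂, HasYoungIntegral f₂ g 0 t y) ∧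
      dist x y ≤ M * (dist (F₁ 0) (F₂ 0) +
        ∫ s in (0 : ℝ)..T, dist (hukuharaDeriv T F₁ s) (hukuharaDeriv T F₂ s)) := by
  have h0 : (0 : ℝ) ∈ Icc 0 T := left_mem_Icc.2 (ht.1.trans ht.2)
  have hM0 : 0 ≤ M := (abs_nonneg _).trans (hM 0 h0 t ht)
  obtain ⟨f₂, hf₂, hinit, hderiv⟩ := hF₂.exists_mem_IS_deriv_ae_eq_proj (ht.1.trans ht.2) hp hD₂
    (f₁ 0) hf₁.2.2.1.1
  have hderiv_dist : ∀ᵐ s ∂volume.restrict (Icc 0 T), ‖(deriv f₁ - deriv f₂) s‖ ≤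
      dist (hukuharaDeriv T F₁ s) (hukuharaDeriv T F₂ s) := by
    filter_upwards [hderiv, IS.ae_deriv_mem hf₁] with s hs₂ hs₁
    rw [Pi.sub_apply, hs₂, ← dist_eq_norm]
    exact dist_proj_le_dist _ hs₁
  refine ⟨_, ⟨f₂, hf₂, IS.hasYoungIntegral hf₂ hp hg ht⟩, ?_⟩
  rw [hx.unique ht.1 (IS.hasYoungIntegral hf₁ hp hg ht), dist_eq_norm, ← integralOfPrimitive_sub hg
    (IS.integrableOn_deriv hf₁ hp) (IS.integrableOn_deriv hf₂ hp) ht]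
  refine (norm_integralOfPrimitive_le hM hdist hderiv_dist ht).trans ?_
  gcongr
  rw [hinit, ← dist_eq_norm]
  exact dist_proj_le_dist _ (hf₁.2.1 0 h0)

theorem hausdorffDist_setYoungIntegral_le [SecondCountableTopology E] [CompleteSpace E] (hp : 1 < p)
    (hg : ContinuousOn g (Icc 0 T)) (hM : ∀ s ∈ Icc 0 T, ∀ t ∈ Icc 0 T, |g t - g s| ≤ M)
    (hF₁ : HukuharaDifferentiable T F₁) (hF₂ : HukuharaDifferentiable T F₂)
    (hD₁ : MemLp (fun s => setNorm (hukuharaDeriv T F₁ s)) (ENNReal.ofReal p)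
      (volume.restrict (Icc 0 T)))
    (hD₂ : MemLp (fun s => setNorm (hukuharaDeriv T F₂ s)) (ENNReal.ofReal p)
      (volume.restrict (Icc 0 T)))
    (ht : t ∈ Icc 0 T) :
    Metric.hausdorffDist (setYoungIntegral p T F₁ g t) (setYoungIntegral p T F₂ g t) ≤
      M * (dist (F₁ 0) (F₂ 0) +
        ∫ s in (0 : ℝ)..T, dist (hukuharaDeriv T F₁ s) (hukuharaDeriv T F₂ s)) := by
  have hT : 0 ≤ T := ht.1.trans ht.2
  have hM0 : 0 ≤ M := (abs_nonneg _).trans (hM 0 (left_mem_Icc.2 hT) t ht)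
  have hI := integral_dist_hukuharaDeriv_nonneg hT F₁ F₂
  have hdist := integrableOn_dist_hukuharaDeriv hp hF₁ hF₂ hD₁ hD₂
  rw [setYoungIntegral, setYoungIntegral, Metric.hausdorffDist_closure]
  refine Metric.hausdorffDist_le_of_mem_dist (by positivity) ?_ ?_
  · rintro x ⟨f, hf, hx⟩
    exact exists_hasYoungIntegral_dist_le hp hg hM hF₂ hD₂ hdist ht hf hx
  · rintro x ⟨f, hf, hx⟩
    simp only [dist_comm (F₁ 0), dist_comm (hukuharaDeriv T F₁ _)] at hdist ⊢
    exact exists_hasYoungIntegral_dist_le hp hg hM hF₁ hD₁ hdist ht hf hx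

end SetYoungIntegral

end

end SetYoung

theorem theorem6_general {E : Type*} [NormedAddCommGroup E] [InnerProductSpace ℝ E]
    [ProperSpace E] {p T M : ℝ} (hT : 0 ≤ T) (hp : 1 < p) {g : ℝ → ℝ}
    (hg : ContinuousOn g (Icc 0 T)) (hM : ∀ s ∈ Icc 0 T, ∀ t ∈ Icc 0 T, |g t - g s| ≤ M)
    {F₁ F₂ : ℝ → ConvexBody E} (hF₁ : HukuharaDifferentiable T F₁)
    (hF₂ : HukuharaDifferentiable T F₂)
    (hD₁ : MemLp (fun s => setNorm (hukuharaDeriv T F₁ s)) (ENNReal.ofReal p)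
      (volume.restrict (Icc 0 T)))
    (hD₂ : MemLp (fun s => setNorm (hukuharaDeriv T F₂ s)) (ENNReal.ofReal p)
      (volume.restrict (Icc 0 T))) :
    IntervalIntegrable (fun s => dist (hukuharaDeriv T F₁ s) (hukuharaDeriv T F₂ s)) volume 0 T ∧
      ∀ t ∈ Icc 0 T,
        (∀ f ∈ IS p T F₁ ∪ IS p T F₂, ∃ x, HasYoungIntegral f g 0 t x) ∧
        (setYoungIntegral p T F₁ g t).Nonempty ∧ IsCompact (setYoungIntegral p T F₁ g t) ∧
        (setYoungIntegral p T F₂ g t).Nonempty ∧ IsCompact (setYoungIntegral p T F₂ g t) ∧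
        Metric.hausdorffDist (setYoungIntegral p T F₁ g t) (setYoungIntegral p T F₂ g t) ≤
          M * (dist (F₁ 0) (F₂ 0) +
            ∫ s in (0 : ℝ)..T, dist (hukuharaDeriv T F₁ s) (hukuharaDeriv T F₂ s)) := by
  have hdist := integrableOn_dist_hukuharaDeriv hp hF₁ hF₂ hD₁ hD₂
  refine ⟨intervalIntegrable_of_integrableOn_Icc hdist (left_mem_Icc.2 hT) (right_mem_Icc.2 hT),
    fun t ht => ⟨?_, setYoungIntegral_nonempty hp hg hF₁ hD₁ ht,
      isCompact_setYoungIntegral hp hg hM hD₁ ht, setYoungIntegral_nonempty hp hg hF₂ hD₂ ht,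
      isCompact_setYoungIntegral hp hg hM hD₂ ht,
      hausdorffDist_setYoungIntegral_le hp hg hM hF₁ hF₂ hD₁ hD₂ ht⟩⟩
  rintro f (hf | hf)
  · exact ⟨_, IS.hasYoungIntegral hf hp hg ht⟩
  · exact ⟨_, IS.hasYoungIntegral hf hp hg ht⟩

theorem theorem6 (d : ℕ) (T : ℝ) (hT : 0 < T) (α β : ℝ) (hα : 0 < α) (hα1 : α ≤ 1)
    (hβ : 0 < β) (hβ1 : β ≤ 1) (g : ℝ → ℝ) (hg : IsHolder α T g)
    (ρ : ℝ) (hρα : 1 - α < ρ) (hρβ : ρ < β) :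
    ∃ C : ℝ, 0 < C ∧
      ∀ p : ℝ, 1 < p → 1 < 1 / p + α →
      ∀ F₁ F₂ : ℝ → ConvexBody (EuclideanSpace ℝ (Fin d)),
        HukuharaDifferentiable T F₁ → HukuharaDifferentiable T F₂ →
        BddAbove (derivNorms T F₁) → BddAbove (derivNorms T F₂) →
        F₁ 0 = F₂ 0 →
        -- the objects in the inequality are well defined
        IntervalIntegrable (fun s => dist (hukuharaDeriv T F₁ s) (hukuharaDeriv T F₂ s))
          MeasureTheory.volume 0 T ∧
        ∀ t ∈ Set.Icc 0 T,
          (∀ f ∈ IS p T F₁ ∪ IS p T F₂, ∃ x, HasYoungIntegral f g 0 t x) ∧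
          (setYoungIntegral p T F₁ g t).Nonempty ∧ IsCompact (setYoungIntegral p T F₁ g t) ∧
          (setYoungIntegral p T F₂ g t).Nonempty ∧ IsCompact (setYoungIntegral p T F₂ g t) ∧
          -- the inequality
          ∀ θ ∈ Set.Ioc (0 : ℝ) 1,
            Metric.hausdorffDist (setYoungIntegral p T F₁ g t) (setYoungIntegral p T F₂ g t) ≤
              C * ((∫ s in (0 : ℝ)..T, dist (hukuharaDeriv T F₁ s) (hukuharaDeriv T F₂ s)) +
                  (T + T ^ (1 - β)) * (sSup (derivNorms T F₁) + sSup (derivNorms T F₂)) * θ ^ β) *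
                θ ^ (-ρ) +
              holderConst α T g * T ^ α *
                ∫ s in (0 : ℝ)..T, dist (hukuharaDeriv T F₁ s) (hukuharaDeriv T F₂ s) := by
  refine ⟨1, one_pos, fun p hp _ F₁ F₂ hF₁ hF₂ hB₁ hB₂ h0 => ?_⟩
  obtain ⟨hint, h⟩ := theorem6_general hT.le hp (hg.continuousOn hα)
    (fun s hs t ht => hg.abs_sub_le_mul_rpow hα.le hs ht) hF₁ hF₂
    (hF₁.memLp_setNorm_hukuharaDeriv hB₁ _) (hF₂.memLp_setNorm_hukuharaDeriv hB₂ _)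
  rw [h0, dist_self, zero_add] at h
  refine ⟨hint, fun t ht => ?_⟩
  obtain ⟨hexists, hne₁, hcompact₁, hne₂, hcompact₂, hle⟩ := h t ht
  exact ⟨hexists, hne₁, hcompact₁, hne₂, hcompact₂, fun θ hθ => hle.trans <|
    le_add_of_nonneg_left <|
      mul_integral_dist_add_mul_rpow_nonneg zero_le_one hT.le hθ.1.le β ρ F₁ F₂⟩
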